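/- Let $0<\underline a\le\overline a$, $0<\underline b\le\overline b$, $0\le\underline c\le\overline c$ and $\underline s\le\overline s$ be real numbers, let $$\mathcal D=[\underline a,\overline a]\times[\underline b,\overline b]\times[\underline c,\overline c]\times[\underline s,\overline s]\subset\mathbb R^4,$$ and denote the points of $\mathbb R^4$ by $z=(c_{ii},c_{jj},c_{ij},s_{ij})$. Put $$\mathcal K^{=}=\{z\in\mathcal D: c_{ij}^2+s_{ij}^2=c_{ii}c_{jj}\},\qquad \mathcal K^{\ge}=\{z\in\mathcal D: c_{ij}^2+s_{ij}^2\ge c_{ii}c_{jj}\}.$$ On each of the $32$ edges of $\mathcal D$ (three of the variables are fixed to one of their two bounds, and these fixed values are written with a hat; the fourth variable runs over its interval) a finite set $E$ of values of the fourth variable is computed as follows. 1. If $c_{ii}$ varies: let $\phi=(\hat c_{ij}^2+\hat s_{ij}^2)/\hat c_{jj}$; then $E=\emptyset$ if $\phi<\underline a$, $E=\{\underline a,\phi\}$ if $\underline a\le\phi\le\overline a$, and $E=\{\underline a,\overline a\}$ if $\phi>\overline a$. If $c_{jj}$ varies: the same with $\phi=(\hat c_{ij}^2+\hat s_{ij}^2)/\hat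 c_{ii}$ and $\underline b,\overline b$ in place of $\underline a,\overline a$. 2. If $c_{ij}$ varies: let $\phi=\hat c_{ii}\hat c_{jj}-\hat s_{ij}^2$; then $E=\{\underline c,\overline c\}$ if $\phi<0$ or $\sqrt\phi<\underline c$, $E=\{\sqrt\phi,\overline c\}$ if $\phi\ge0$ and $\underline c\le\sqrt\phi\le\overline c$, and $E=\emptyset$ if $\phi\ge 0$ and $\sqrt\phi>\overline c$. 3. If $s_{ij}$ varies: let $\phi=\hat c_{ii}\hat c_{jj}-\hat c_{ij}^2$. If $\phi<0$, then $E=\{\underline s,\overline s\}$. If $\phi\ge0$, then $$E=\begin{cases}\{\underline s,\overline s\} & \text{if } \overline s<-\sqrt\phi,\\ \{\underline s,-\sqrt\phi\} & \text{if } \underline s\le-\sqrt\phi\le\overline s<\sqrt\phi,\\ \{\underline s,-\sqrt\phi,\sqrt\phi,\overline s\} & \text{if } \underline s\le-\sqrt\phi \text{ and } \sqrt\phi\le\overline s,\\ \emptyset & \text{if } -\sqrt\phi<\underline s \text{ and } \overline s<\sqrt\phi,\\ \{\sqrt\phi,\overline s\} & \text{if } -\sqrt\phi<\underline s\le\sqrt\phi\le\overline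 s,\\ \{\underline s,\overline s\} & \text{if } \sqrt\phi<\underline s.\end{cases}$$ Let $Z$ be the finite set of all points of $\mathcal D$ obtained in this way on the $32$ edges. For a finite set $W=\{z^1,\dots,z^K\}\subset\mathbb R^4$ let $$H(W)=\Bigl\{z\in\mathcal D:\ \exists\lambda\in\mathbb R^K:\ c_{ij}^2+s_{ij}^2\le c_{ii}c_{jj},\ z=\sum_{k=1}^K\lambda_kz^k,\ \sum_{k=1}^K\lambda_k=1,\ \lambda\ge0\Bigr\}.$$ Then $\operatorname{conv}(\mathcal K^{=})=H(Z)$. Moreover, the set $Z'$ of extreme points of $\operatorname{conv}(\mathcal K^{\ge})$ is contained in $Z$, has at most $32$ elements, and also satisfies $\operatorname{conv}(\mathcal K^{=})=H(Z')$. -/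

import Mathlib

/-- Bounds of a box in the space of the four real variables `(c_ii, c_jj, c_ij, s_ij)`. -/
structure EdgeBox where
  ciiLo : ℝ
  ciiHi : ℝ
  cjjLo : ℝ
  cjjHi : ℝ
  cijLo : ℝ
  cijHi : ℝ
  sijLo : ℝ
  sijHi : ℝ

/-- Points `(c_ii, c_jj, c_ij, s_ij)`. -/
abbrev EdgePoint : Type := ℝ × ℝ × ℝ × ℝ

namespace EdgeBox

/-- The box `[c̲_ii, c̅_ii] × [c̲_jj, c̅_jj] × [c̲_ij, c̅_ij] × [s̲_ij, s̅_ij]`. -/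
def D (B : EdgeBox) : Set EdgePoint :=
  Set.Icc B.ciiLo B.ciiHi ×ˢ Set.Icc B.cjjLo B.cjjHi ×ˢ
    Set.Icc B.cijLo B.cijHi ×ˢ Set.Icc B.sijLo B.sijHi

/-- Points of the box with `c_ij² + s_ij² = c_ii c_jj`. -/
def KEq (B : EdgeBox) : Set EdgePoint :=
  {z | z ∈ B.D ∧ z.2.2.1 ^ 2 + z.2.2.2 ^ 2 = z.1 * z.2.1}

/-- Points of the box with `c_ij² + s_ij² ≥ c_ii c_jj`. -/
def KGe (B : EdgeBox) : Set EdgePoint :=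
  {z | z ∈ B.D ∧ z.2.2.1 ^ 2 + z.2.2.2 ^ 2 ≥ z.1 * z.2.1}

/-- On an edge of the box on which only one diagonal variable (`c_ii` or `c_jj`) varies, over
`[lo, hi]`: the values returned when the other diagonal variable, `c_ij` and `s_ij`
are fixed to `d`, `c` and `s`. -/
noncomputable def algDiag (lo hi d c s : ℝ) : Finset ℝ :=
  let φ := (c ^ 2 + s ^ 2) / d
  if φ < lo then ∅
  else if φ ≤ hi then {lo, φ}
  else {lo, hi}

/-- On an edge of the box on which only `c_ij` varies, over `[lo, hi]`: the values returned
when `c_ii`, `c_jj` and `s_ij` are fixed to `a`, `b` and `s`. -/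
noncomputable def algC (lo hi a b s : ℝ) : Finset ℝ :=
  let φ := a * b - s ^ 2
  if φ < 0 then {lo, hi}
  else if √φ < lo then {lo, hi}
  else if √φ ≤ hi then {√φ, hi}
  else ∅

/-- On an edge of the box on which only `s_ij` varies, over `[lo, hi]`: the values returned
when `c_ii`, `c_jj` and `c_ij` are fixed to `a`, `b` and `c`. -/
noncomputable def algS (lo hi a b c : ℝ) : Finset ℝ :=
  let φ := a * b - c ^ 2
  if φ < 0 then {lo, hi}
  else if hi < -√φ then {lo, hi}
  else if lo ≤ -√φ ∧ hi < √φ then {lo, -√φ}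
  else if lo ≤ -√φ ∧ √φ ≤ hi then {lo, -√φ, √φ, hi}
  else if -√φ < lo ∧ hi < √φ then ∅
  else if lo ≤ √φ ∧ √φ ≤ hi then {√φ, hi}
  else {lo, hi}

/-- All points returned on the eight edges on which `c_ii` varies. -/
noncomputable def pointsCii (B : EdgeBox) : Finset EdgePoint :=
  (({B.cjjLo, B.cjjHi} : Finset ℝ) ×ˢ ({B.cijLo, B.cijHi} : Finset ℝ) ×ˢ
      ({B.sijLo, B.sijHi} : Finset ℝ)).biUnion fun v =>
    (algDiag B.ciiLo B.ciiHi v.1 v.2.1 v.2.2).image fun t => (t, v.1, v.2.1, v.2.2)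

/-- All points returned on the eight edges on which `c_jj` varies. -/
noncomputable def pointsCjj (B : EdgeBox) : Finset EdgePoint :=
  (({B.ciiLo, B.ciiHi} : Finset ℝ) ×ˢ ({B.cijLo, B.cijHi} : Finset ℝ) ×ˢ
      ({B.sijLo, B.sijHi} : Finset ℝ)).biUnion fun v =>
    (algDiag B.cjjLo B.cjjHi v.1 v.2.1 v.2.2).image fun t => (v.1, t, v.2.1, v.2.2)

/-- All points returned on the eight edges on which `c_ij` varies. -/
noncomputable def pointsCij (B : EdgeBox) : Finset EdgePoint :=
  (({B.ciiLo, B.ciiHi} : Finset ℝ) ×ˢ ({B.cjjLo, B.cjjHi} : Finset ℝ) ×ˢ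
      ({B.sijLo, B.sijHi} : Finset ℝ)).biUnion fun v =>
    (algC B.cijLo B.cijHi v.1 v.2.1 v.2.2).image fun t => (v.1, v.2.1, t, v.2.2)

/-- All points returned on the eight edges on which `s_ij` varies. -/
noncomputable def pointsSij (B : EdgeBox) : Finset EdgePoint :=
  (({B.ciiLo, B.ciiHi} : Finset ℝ) ×ˢ ({B.cjjLo, B.cjjHi} : Finset ℝ) ×ˢ
      ({B.cijLo, B.cijHi} : Finset ℝ)).biUnion fun v =>
    (algS B.sijLo B.sijHi v.1 v.2.1 v.2.2).image fun t => (v.1, v.2.1, v.2.2, t)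

/-- All points returned by the procedures on the 32 edges of the box. -/
noncomputable def algPoints (B : EdgeBox) : Finset EdgePoint :=
  B.pointsCii ∪ B.pointsCjj ∪ B.pointsCij ∪ B.pointsSij

/-- Points of the box that satisfy `c_ij² + s_ij² ≤ c_ii c_jj` and are convex combinations
of the points of `Z`. -/
def hullDescription (B : EdgeBox) (Z : Finset EdgePoint) : Set EdgePoint :=
  {z | z ∈ B.D ∧ ∃ w : EdgePoint → ℝ,
    z.2.2.1 ^ 2 + z.2.2.2 ^ 2 ≤ z.1 * z.2.1 ∧
    z = ∑ p ∈ Z, w p • p ∧ ∑ p ∈ Z, w p = 1 ∧ ∀ p ∈ Z, 0 ≤ w p}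

end EdgeBox

/-! Write q for c_ij² + s_ij² − c_ii c_jj. Inside the box, q ≤ 0 cuts out a convex piece of a
rotated second-order cone, so conv(K⁼) lies in the compact convex set conv(K≥) ∩ {q ≤ 0}.
Conversely, by Krein–Milman it is enough to look at extreme points of that intersection. One with q
< 0 would already be extreme in conv(K≥), because the cut is inactive near it, and would thus lie in
K≥, which is absurd. Hence q = 0 there, and the two sets agree (`convexHull_KEq_eq`).

It remains to generate conv(K≥) by finitely many points. If two variables are strictly between their
bounds at e, the face has a nonzero direction d tangent to q at e with q(d) ≥ 0; then e ± r d stay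
in K≥ for small r and e is not extreme. So an extreme point is a vertex, or lies inside an edge with
q = 0 (`extremePoints_cases`). The edge procedures return all these points and nothing outside K≥,
so their output has the same hull.

For the count, q is convex along each edge, so the edge has at most one extreme point in its
relative interior, and then exactly one feasible end. Since q decreases in c_ii and c_jj and
increases in c_ij, the counts on those edges are bounded by differences of vertex indicators. Adding
the vertices themselves, cancellation leaves at most 20; the eight s_ij edges add at most 8. -/

/-! ### Compactness of convex hulls -/

/-- In a finite-dimensional space the convex hull of a compact set is compact. -/
theorem IsCompact.isCompact_convexHull_of_finiteDimensional {E : Type*} [NormedAddCommGroup E]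
    [NormedSpace ℝ E] [FiniteDimensional ℝ E] {s : Set E} (hs : IsCompact s) :
    IsCompact (convexHull ℝ s) := by
  rcases s.eq_empty_or_nonempty with rfl | ⟨x₀, hx₀⟩
  · simp
  let n := Module.finrank ℝ E + 1
  have hcont : Continuous fun p : (Fin n → ℝ) × (Fin n → E) => ∑ i, p.1 i • p.2 i := by
    fun_prop
  have himage : convexHull ℝ s = (fun p : (Fin n → ℝ) × (Fin n → E) => ∑ i, p.1 i • p.2 i) ''
      (stdSimplex ℝ (Fin n) ×ˢ Set.pi Set.univ fun _ => s) := by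
    ext x
    constructor
    · intro hx
      obtain ⟨ι, _, z, w, hz, hind, hw, hw1, rfl⟩ := eq_pos_convex_span_of_mem_convexHull hx
      have hcard : Fintype.card ι ≤ Fintype.card (Fin n) := by
        rw [Fintype.card_fin]
        exact hind.card_le_finrank_succ.trans
          (Nat.succ_le_succ (Submodule.finrank_le _))
      obtain ⟨g⟩ := Function.Embedding.nonempty_of_card_le hcard
      have hout : ∀ j, j ∉ Set.range g → Function.extend g w 0 j = 0 := fun j hj =>
        Function.extend_apply' _ _ _ hj
      -- Padding the Carathéodory representation with zero weights at `x₀` fixes the number of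
      -- points, so a single compact parameter space covers the whole hull.
      refine ⟨(Function.extend g w 0, Function.extend g z fun _ => x₀), ⟨⟨fun j => ?_, ?_⟩, ?_⟩, ?_⟩
      · by_cases hj : j ∈ Set.range g
        · obtain ⟨i, rfl⟩ := hj
          simpa [g.injective.extend_apply] using (hw i).le
        · exact (hout j hj).ge
      · rw [← hw1]
        exact (Fintype.sum_of_injective g g.injective _ _ hout
          fun i => (g.injective.extend_apply _ _ _).symm).symm
      · intro j _
        by_cases hj : j ∈ Set.range g
        · obtain ⟨i, rfl⟩ := hj
          simpa [g.injective.extend_apply] using hz (Set.mem_range_self i)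
        · simpa [Function.extend_apply' _ _ _ hj] using hx₀
      · refine (Fintype.sum_of_injective g g.injective _ _ (fun j hj => ?_) fun i => ?_).symm
        · simp [hout j hj]
        · simp [g.injective.extend_apply]
    · rintro ⟨⟨w, z⟩, ⟨hw, hz⟩, rfl⟩
      exact (convex_convexHull ℝ s).sum_mem (fun i _ => hw.1 i) hw.2
        fun i _ => subset_convexHull ℝ s (hz i (Set.mem_univ i))
  rw [himage]
  exact ((isCompact_stdSimplex ℝ (Fin n)).prod (isCompact_univ_pi fun _ => hs)).image hcont

/-! ### The quadratic form and the hull of K⁼ -/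

namespace EdgeBox

/-- The quadratic form `c_ij² + s_ij² - c_ii c_jj`. -/
def quad (z : EdgePoint) : ℝ := z.2.2.1 ^ 2 + z.2.2.2 ^ 2 - z.1 * z.2.1

/-- Twice the polarization of `quad`. -/
def quadBilin (z d : EdgePoint) : ℝ :=
  2 * z.2.2.1 * d.2.2.1 + 2 * z.2.2.2 * d.2.2.2 - z.1 * d.2.1 - z.2.1 * d.1

theorem quad_add_smul (z d : EdgePoint) (t : ℝ) :
    quad (z + t • d) = quad z + t * quadBilin z d + t ^ 2 * quad d := by
  simp only [quad, quadBilin, Prod.fst_add, Prod.snd_add, Prod.smul_fst, Prod.smul_snd,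
    smul_eq_mul]
  ring

theorem continuous_quad : Continuous quad := by
  unfold quad; fun_prop

theorem mem_D {B : EdgeBox} {z : EdgePoint} :
    z ∈ B.D ↔ (B.ciiLo ≤ z.1 ∧ z.1 ≤ B.ciiHi) ∧ (B.cjjLo ≤ z.2.1 ∧ z.2.1 ≤ B.cjjHi) ∧
      (B.cijLo ≤ z.2.2.1 ∧ z.2.2.1 ≤ B.cijHi) ∧ (B.sijLo ≤ z.2.2.2 ∧ z.2.2.2 ≤ B.sijHi) :=
  Iff.rfl

theorem mem_KGe {B : EdgeBox} {z : EdgePoint} : z ∈ B.KGe ↔ z ∈ B.D ∧ 0 ≤ quad z := by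
  simp [KGe, quad]

theorem mem_KEq {B : EdgeBox} {z : EdgePoint} : z ∈ B.KEq ↔ z ∈ B.D ∧ quad z = 0 := by
  simp [KEq, quad, sub_eq_zero]

theorem isCompact_D (B : EdgeBox) : IsCompact B.D :=
  isCompact_Icc.prod (isCompact_Icc.prod (isCompact_Icc.prod isCompact_Icc))

theorem convex_D (B : EdgeBox) : Convex ℝ B.D :=
  (convex_Icc _ _).prod ((convex_Icc _ _).prod ((convex_Icc _ _).prod (convex_Icc _ _)))

theorem isCompact_KGe (B : EdgeBox) : IsCompact B.KGe := by
  have h : B.KGe = B.D ∩ quad ⁻¹' Set.Ici 0 := by ext z; simp [mem_KGe]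
  rw [h]
  exact B.isCompact_D.inter_right (isClosed_Ici.preimage continuous_quad)

theorem isCompact_KEq (B : EdgeBox) : IsCompact B.KEq := by
  have h : B.KEq = B.D ∩ quad ⁻¹' {0} := by ext z; simp [mem_KEq]
  rw [h]
  exact B.isCompact_D.inter_right (isClosed_singleton.preimage continuous_quad)

theorem convexHull_KGe_subset_D (B : EdgeBox) : convexHull ℝ B.KGe ⊆ B.D :=
  convexHull_min (fun _ hz => hz.1) B.convex_D

theorem mem_hullDescription {B : EdgeBox} {Z : Finset EdgePoint} {z : EdgePoint} :
    z ∈ B.hullDescription Z ↔ z ∈ B.D ∧ quad z ≤ 0 ∧ z ∈ convexHull ℝ (Z : Set EdgePoint) := by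
  rw [Finset.mem_convexHull', hullDescription, quad, sub_nonpos]
  constructor
  · rintro ⟨hD, w, hq, hz, h1, h0⟩
    exact ⟨hD, hq, w, h0, h1, hz.symm⟩
  · rintro ⟨hD, hq, w, h0, h1, hz⟩
    exact ⟨hD, w, hq, hz.symm, h1, h0⟩

/-- The rotated second-order cone is convex, within the box. -/
theorem convex_D_inter_quad_nonpos {B : EdgeBox} (hcii : 0 < B.ciiLo) (hcjj : 0 < B.cjjLo) :
    Convex ℝ (B.D ∩ {z | quad z ≤ 0}) := by
  rintro x ⟨hxD, hx⟩ y ⟨hyD, hy⟩ s t hs ht hst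
  refine ⟨B.convex_D hxD hyD hs ht hst, ?_⟩
  obtain ⟨a, b, c, d⟩ := x
  obtain ⟨a', b', c', d'⟩ := y
  simp only [mem_D] at hxD hyD
  simp only [quad, Set.mem_ofPred_eq, Prod.smul_mk, Prod.mk_add_mk, smul_eq_mul] at hx hy ⊢
  have ha : 0 < a := by linarith
  have hb : 0 < b := by linarith
  have ha' : 0 < a' := by linarith
  have hb' : 0 < b' := by linarith
  -- Cauchy–Schwarz for (c, d) and (c', d'), then AM–GM for a b' and a' b; this controls the cross
  -- term of the convex combination.
  have hcs : (2 * (c * c' + d * d')) ^ 2 ≤ (a * b' + a' * b) ^ 2 := by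
    have h1 : (c ^ 2 + d ^ 2) * (c' ^ 2 + d' ^ 2) ≤ (a * b) * (a' * b') := by
      apply mul_le_mul <;> first | linarith | positivity
    nlinarith [sq_nonneg (c * d' - d * c'), sq_nonneg (a * b' - a' * b)]
  have hmix : 2 * (c * c' + d * d') ≤ a * b' + a' * b :=
    (abs_le_of_sq_le_sq' hcs (by positivity)).2
  nlinarith [mul_le_mul_of_nonneg_left hmix (mul_nonneg hs ht),
    mul_le_mul_of_nonneg_left hx (mul_nonneg hs hs),
    mul_le_mul_of_nonneg_left hy (mul_nonneg ht ht)]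

/-- A point of the cone's interior that is extreme in the truncation of `A` by the cone is
extreme in `A`. -/
theorem mem_extremePoints_of_quad_neg {A : Set EdgePoint} (hA : Convex ℝ A) {e : EdgePoint}
    (he : e ∈ (A ∩ {z | quad z ≤ 0}).extremePoints ℝ) (hq : quad e < 0) :
    e ∈ A.extremePoints ℝ := by
  rw [mem_extremePoints_iff_left] at he ⊢
  refine ⟨he.1.1, fun x hx y hy hxy => ?_⟩
  have hev : ∀ v : EdgePoint, ∀ᶠ r : ℝ in nhdsWithin 0 (Set.Ioi 0),
      quad (e + r • (v - e)) < 0 := fun v => by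
    have hc : Continuous fun r : ℝ => quad (e + r • (v - e)) :=
      continuous_quad.comp (by fun_prop)
    exact nhdsWithin_le_nhds (hc.continuousAt.eventually_lt continuousAt_const (by simpa using hq))
  have hIoo : ∀ᶠ r : ℝ in nhdsWithin 0 (Set.Ioi 0), r ∈ Set.Ioo (0 : ℝ) 1 :=
    Ioo_mem_nhdsGT one_pos
  -- Contracting `x` and `y` towards `e` by the same factor `r` keeps `e` the same convex
  -- combination and moves both ends into the region where `quad` is negative.
  obtain ⟨r, hrx, hry, hr0, hr1⟩ := ((hev x).and ((hev y).and hIoo)).exists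
  have hmem : ∀ v ∈ A, e + r • (v - e) ∈ A := fun v hv =>
    hA.add_smul_sub_mem he.1.1 hv ⟨hr0.le, hr1.le⟩
  obtain ⟨α, β, hα, hβ, hαβ, hsum⟩ := hxy
  have heq := he.2 _ ⟨hmem x hx, hrx.le⟩ _ ⟨hmem y hy, hry.le⟩ ⟨α, β, hα, hβ, hαβ, by
    have hβ' : β = 1 - α := by linarith
    subst hβ'
    have : α • (e + r • (x - e)) + (1 - α) • (e + r • (y - e)) =
        e + r • ((α • x + (1 - α) • y) - e) := by module
    rw [this, hsum]; simp⟩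
  have h0 : r • (x - e) = 0 := by simpa using heq
  exact sub_eq_zero.1 ((smul_eq_zero.1 h0).resolve_left hr0.ne')

theorem convexHull_KEq_eq {B : EdgeBox} (hcii : 0 < B.ciiLo) (hcjj : 0 < B.cjjLo) :
    convexHull ℝ B.KEq = convexHull ℝ B.KGe ∩ {z | quad z ≤ 0} := by
  have hinter : convexHull ℝ B.KGe ∩ {z | quad z ≤ 0} =
      convexHull ℝ B.KGe ∩ (B.D ∩ {z | quad z ≤ 0}) := by
    rw [← Set.inter_assoc, Set.inter_eq_left.2 B.convexHull_KGe_subset_D]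
  have hconv : Convex ℝ (convexHull ℝ B.KGe ∩ {z | quad z ≤ 0}) := by
    rw [hinter]
    exact (convex_convexHull ℝ _).inter (convex_D_inter_quad_nonpos hcii hcjj)
  have hcomp : IsCompact (convexHull ℝ B.KGe ∩ {z | quad z ≤ 0}) :=
    B.isCompact_KGe.isCompact_convexHull_of_finiteDimensional.inter_right
      (isClosed_Iic.preimage continuous_quad)
  refine (convexHull_min (fun z hz => ?_) hconv).antisymm ?_
  · rw [mem_KEq] at hz
    exact ⟨subset_convexHull ℝ _ (mem_KGe.2 ⟨hz.1, hz.2.ge⟩), hz.2.le⟩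
  · rw [← closure_convexHull_extremePoints hcomp hconv]
    refine closure_minimal (convexHull_mono fun e he => ?_)
      B.isCompact_KEq.isCompact_convexHull_of_finiteDimensional.isClosed
    refine mem_KEq.2 ⟨B.convexHull_KGe_subset_D he.1.1, he.1.2.antisymm ?_⟩
    by_contra! hneg
    exact hneg.not_ge (mem_KGe.1 (extremePoints_convexHull_subset
      (mem_extremePoints_of_quad_neg (convex_convexHull ℝ _) he hneg))).2

end EdgeBox

/-! ### Extreme points of the hull of K≥ lie on edges -/

namespace EdgeBox

theorem eventually_mem_Icc_add_mul {lo hi x δ : ℝ} (hx : lo ≤ x ∧ x ≤ hi)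
    (hδ : δ ≠ 0 → lo < x ∧ x < hi) :
    ∀ᶠ r : ℝ in nhds 0, lo ≤ x + r * δ ∧ x + r * δ ≤ hi := by
  by_cases h : δ = 0
  · simp [h, hx]
  · have hc : Continuous fun r : ℝ => x + r * δ := by fun_prop
    have h1 := (continuousAt_const (y := lo)).eventually_lt (hc.continuousAt (x := 0))
      (by simpa using (hδ h).1)
    have h2 := (hc.continuousAt (x := 0)).eventually_lt (continuousAt_const (y := hi))
      (by simpa using (hδ h).2)
    filter_upwards [h1, h2] with r hr1 hr2 using ⟨hr1.le, hr2.le⟩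

/-- An extreme point of the hull of `K≥` admits no feasible direction `d` in the face of the box
containing it along which the quadratic constraint stays satisfied in both senses. -/
theorem eq_zero_of_feasible_direction {B : EdgeBox} {e d : EdgePoint}
    (he : e ∈ (convexHull ℝ B.KGe).extremePoints ℝ)
    (h1 : d.1 ≠ 0 → B.ciiLo < e.1 ∧ e.1 < B.ciiHi)
    (h2 : d.2.1 ≠ 0 → B.cjjLo < e.2.1 ∧ e.2.1 < B.cjjHi)
    (h3 : d.2.2.1 ≠ 0 → B.cijLo < e.2.2.1 ∧ e.2.2.1 < B.cijHi)
    (h4 : d.2.2.2 ≠ 0 → B.sijLo < e.2.2.2 ∧ e.2.2.2 < B.sijHi)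
    (hq : quad e = 0 → quadBilin e d = 0 ∧ 0 ≤ quad d) : d = 0 := by
  obtain ⟨heD, heq⟩ := mem_KGe.1 (extremePoints_convexHull_subset he)
  have hD := mem_D.1 heD
  have hquad : ∀ᶠ r : ℝ in nhds 0, 0 ≤ quad (e + r • d) := by
    rcases heq.eq_or_lt with h0 | hpos
    · obtain ⟨hb, hd⟩ := hq h0.symm
      refine Filter.Eventually.of_forall fun r => ?_
      rw [quad_add_smul, ← h0, hb]
      nlinarith [mul_nonneg (sq_nonneg r) hd]
    · have hc : Continuous fun r : ℝ => quad (e + r • d) := continuous_quad.comp (by fun_prop)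
      filter_upwards [(hc.continuousAt (x := 0)).eventually
        (lt_mem_nhds (a := 0) (by simpa using hpos))] with r hr using hr.le
  have hK : ∀ᶠ r : ℝ in nhds 0, e + r • d ∈ B.KGe := by
    filter_upwards [hquad, eventually_mem_Icc_add_mul hD.1 h1,
      eventually_mem_Icc_add_mul hD.2.1 h2, eventually_mem_Icc_add_mul hD.2.2.1 h3,
      eventually_mem_Icc_add_mul hD.2.2.2 h4] with r hr hr1 hr2 hr3 hr4
    exact mem_KGe.2 ⟨mem_D.2 ⟨hr1, hr2, hr3, hr4⟩, hr⟩
  have hneg : ∀ᶠ r : ℝ in nhds 0, e + (-r) • d ∈ B.KGe :=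
    (by simpa using (continuous_neg.tendsto (0 : ℝ)) :
      Filter.Tendsto (fun r : ℝ => -r) (nhds 0) (nhds 0)).eventually hK
  -- One `r > 0` works for both signs, which exhibits `e` as the midpoint of `e + r • d` and `e - r
  -- • d`.
  obtain ⟨r, ⟨hr, hr'⟩, hr0⟩ := (((hK.and hneg).filter_mono nhdsWithin_le_nhds).and
    (self_mem_nhdsWithin : Set.Ioi (0 : ℝ) ∈ nhdsWithin 0 (Set.Ioi 0))).exists
  have := (mem_extremePoints_iff_left.1 he).2 _ (subset_convexHull ℝ _ hr) _
    (subset_convexHull ℝ _ hr') ⟨1 / 2, 1 / 2, by norm_num, by norm_num, by norm_num, by module⟩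
  have h0 : r • d = 0 := by simpa using this
  exact (smul_eq_zero.1 h0).resolve_left (ne_of_gt hr0)

/-- The value `x` is one of the two bounds. -/
def AtBound (lo hi x : ℝ) : Prop := x = lo ∨ x = hi

theorem atBound_or_interior {lo hi x : ℝ} (hx : lo ≤ x ∧ x ≤ hi) :
    AtBound lo hi x ∨ (lo < x ∧ x < hi) := by
  rcases hx.1.eq_or_lt with h | h
  · exact Or.inl (Or.inl h.symm)
  · rcases hx.2.eq_or_lt with h' | h'
    · exact Or.inl (Or.inr h')
    · exact Or.inr ⟨h, h'⟩

/-- At an extreme point of the hull of `K≥`, either all variables are at their bounds or exactly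
one is not, and then the quadratic constraint is active. -/
theorem extremePoints_cases {B : EdgeBox} (hcii : 0 < B.ciiLo) (hcjj : 0 < B.cjjLo)
    {e : EdgePoint} (he : e ∈ (convexHull ℝ B.KGe).extremePoints ℝ) :
    (AtBound B.ciiLo B.ciiHi e.1 ∧ AtBound B.cjjLo B.cjjHi e.2.1 ∧
      AtBound B.cijLo B.cijHi e.2.2.1 ∧ AtBound B.sijLo B.sijHi e.2.2.2) ∨
    ((B.ciiLo < e.1 ∧ e.1 < B.ciiHi) ∧ AtBound B.cjjLo B.cjjHi e.2.1 ∧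
      AtBound B.cijLo B.cijHi e.2.2.1 ∧ AtBound B.sijLo B.sijHi e.2.2.2 ∧ quad e = 0) ∨
    ((B.cjjLo < e.2.1 ∧ e.2.1 < B.cjjHi) ∧ AtBound B.ciiLo B.ciiHi e.1 ∧
      AtBound B.cijLo B.cijHi e.2.2.1 ∧ AtBound B.sijLo B.sijHi e.2.2.2 ∧ quad e = 0) ∨
    ((B.cijLo < e.2.2.1 ∧ e.2.2.1 < B.cijHi) ∧ AtBound B.ciiLo B.ciiHi e.1 ∧
      AtBound B.cjjLo B.cjjHi e.2.1 ∧ AtBound B.sijLo B.sijHi e.2.2.2 ∧ quad e = 0) ∨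
    ((B.sijLo < e.2.2.2 ∧ e.2.2.2 < B.sijHi) ∧ AtBound B.ciiLo B.ciiHi e.1 ∧
      AtBound B.cjjLo B.cjjHi e.2.1 ∧ AtBound B.cijLo B.cijHi e.2.2.1 ∧ quad e = 0) := by
  have hdir := @eq_zero_of_feasible_direction B e
  obtain ⟨heD, -⟩ := mem_KGe.1 (extremePoints_convexHull_subset he)
  have hD := mem_D.1 heD
  obtain ⟨a, b, c, s⟩ := e
  have ha : 0 < a := hcii.trans_le hD.1.1
  have hb : 0 < b := hcjj.trans_le hD.2.1.1
  have hdir' : ∀ α β γ σ : ℝ, (α ≠ 0 → B.ciiLo < a ∧ a < B.ciiHi) →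
      (β ≠ 0 → B.cjjLo < b ∧ b < B.cjjHi) → (γ ≠ 0 → B.cijLo < c ∧ c < B.cijHi) →
      (σ ≠ 0 → B.sijLo < s ∧ s < B.sijHi) →
      (quad (a, b, c, s) = 0 → 2 * c * γ + 2 * s * σ - a * β - b * α = 0 ∧
        0 ≤ γ ^ 2 + σ ^ 2 - α * β) →
      α = 0 ∧ β = 0 ∧ γ = 0 ∧ σ = 0 := fun α β γ σ h1 h2 h3 h4 hq => by
    simpa using hdir (d := (α, β, γ, σ)) he h1 h2 h3 h4 hq
  have one {p : Prop} (hp : p) (x : ℝ) : x ≠ 0 → p := fun _ => hp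
  have zero {p : Prop} : (0 : ℝ) ≠ 0 → p := fun h => (h rfl).elim
  -- For each pair of free variables the witness is tangent to `quad` at `e`. Here its `quad` value
  -- is `a * b`; when one diagonal and one off-diagonal variable are free it is 1.
  have h12 : (B.ciiLo < a ∧ a < B.ciiHi) → (B.cjjLo < b ∧ b < B.cjjHi) → False := fun h h' => by
    have := hdir' a (-b) 0 0 (one h _) (one h' _) zero zero
      fun _ => ⟨by ring, by nlinarith [mul_pos ha hb]⟩
    linarith [this.1]
  have h13 : (B.ciiLo < a ∧ a < B.ciiHi) → (B.cijLo < c ∧ c < B.cijHi) → False := fun h h' => by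
    have := hdir' (2 * c / b) 0 1 0 (one h _) zero (one h' _) zero
      fun _ => ⟨by field_simp; ring, by norm_num⟩
    linarith [this.2.2.1]
  have h14 : (B.ciiLo < a ∧ a < B.ciiHi) → (B.sijLo < s ∧ s < B.sijHi) → False := fun h h' => by
    have := hdir' (2 * s / b) 0 0 1 (one h _) zero zero (one h' _)
      fun _ => ⟨by field_simp; ring, by norm_num⟩
    linarith [this.2.2.2]
  have h23 : (B.cjjLo < b ∧ b < B.cjjHi) → (B.cijLo < c ∧ c < B.cijHi) → False := fun h h' => by
    have := hdir' 0 (2 * c / a) 1 0 zero (one h _) (one h' _) zero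
      fun _ => ⟨by field_simp; ring, by norm_num⟩
    linarith [this.2.2.1]
  have h24 : (B.cjjLo < b ∧ b < B.cjjHi) → (B.sijLo < s ∧ s < B.sijHi) → False := fun h h' => by
    have := hdir' 0 (2 * s / a) 0 1 zero (one h _) zero (one h' _)
      fun _ => ⟨by field_simp; ring, by norm_num⟩
    linarith [this.2.2.2]
  have h34 : (B.cijLo < c ∧ c < B.cijHi) → (B.sijLo < s ∧ s < B.sijHi) → False := fun h h' => by
    -- The tangent direction (s, −c) in the (c_ij, s_ij) plane vanishes when both coordinates do;
    -- for `s = 0` the s_ij axis is itself tangent.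
    by_cases hs0 : s = 0
    · have := hdir' 0 0 0 1 zero zero zero (one h' _) fun _ => ⟨by simp [hs0], by norm_num⟩
      linarith [this.2.2.2]
    · have := hdir' 0 0 s (-c) zero zero (one h _) (one h' _)
        fun _ => ⟨by ring, by nlinarith [sq_nonneg s, sq_nonneg c]⟩
      exact hs0 this.2.2.1
  -- Off the surface the tangency requirement is vacuous, so a single free variable already
  -- contradicts extremality.
  have act : ∀ α β γ σ : ℝ, ¬ (α = 0 ∧ β = 0 ∧ γ = 0 ∧ σ = 0) →
      (α ≠ 0 → B.ciiLo < a ∧ a < B.ciiHi) → (β ≠ 0 → B.cjjLo < b ∧ b < B.cjjHi) →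
      (γ ≠ 0 → B.cijLo < c ∧ c < B.cijHi) → (σ ≠ 0 → B.sijLo < s ∧ s < B.sijHi) →
      quad (a, b, c, s) = 0 := fun α β γ σ hne h1 h2 h3 h4 => by
    by_contra hq
    exact hne (hdir' α β γ σ h1 h2 h3 h4 fun h => (hq h).elim)
  rcases atBound_or_interior hD.1 with hi1 | hi1 <;>
  rcases atBound_or_interior hD.2.1 with hi2 | hi2
  · rcases atBound_or_interior hD.2.2.1 with hi3 | hi3 <;>
    rcases atBound_or_interior hD.2.2.2 with hi4 | hi4
    · exact Or.inl ⟨hi1, hi2, hi3, hi4⟩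
    · exact Or.inr (Or.inr (Or.inr (Or.inr ⟨hi4, hi1, hi2, hi3,
        act 0 0 0 1 (by simp) zero zero zero (one hi4 _)⟩)))
    · exact Or.inr (Or.inr (Or.inr (Or.inl ⟨hi3, hi1, hi2, hi4,
        act 0 0 1 0 (by simp) zero zero (one hi3 _) zero⟩)))
    · exact (h34 hi3 hi4).elim
  · exact Or.inr (Or.inr (Or.inl ⟨hi2, hi1,
      (atBound_or_interior hD.2.2.1).resolve_right (h23 hi2),
      (atBound_or_interior hD.2.2.2).resolve_right (h24 hi2),
      act 0 1 0 0 (by simp) zero (one hi2 _) zero zero⟩))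
  · exact Or.inr (Or.inl ⟨hi1, hi2,
      (atBound_or_interior hD.2.2.1).resolve_right (h13 hi1),
      (atBound_or_interior hD.2.2.2).resolve_right (h14 hi1),
      act 1 0 0 0 (by simp) (one hi1 _) zero zero zero⟩)
  · exact (h12 hi1 hi2).elim

/-! ### Correctness of the edge procedures -/

/-- This is the completeness half: a feasible bound is omitted from the list only if it equals φ,
which is listed instead. The analogues for c_ij and s_ij serve the same purpose. -/
theorem mem_algDiag_of {lo hi d c s t : ℝ} (hd : 0 < d) (hlo : lo ≤ t) (hhi : t ≤ hi)
    (hq : t * d ≤ c ^ 2 + s ^ 2) (ht : AtBound lo hi t ∨ t * d = c ^ 2 + s ^ 2) :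
    t ∈ algDiag lo hi d c s := by
  have hφ : t ≤ (c ^ 2 + s ^ 2) / d := (le_div_iff₀ hd).2 hq
  have ht' : t = lo ∨ t = hi ∨ t = (c ^ 2 + s ^ 2) / d := by
    rcases ht with (h | h) | h
    · exact Or.inl h
    · exact Or.inr (Or.inl h)
    · exact Or.inr (Or.inr ((eq_div_iff hd.ne').2 h))
  simp only [algDiag]
  split_ifs with h1 h2
  · linarith
  · rcases ht' with h | h | h
    · simp [h]
    · have : t = (c ^ 2 + s ^ 2) / d := by linarith
      simp [this]
    · simp [h]
  · rcases ht' with h | h | h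
    · simp [h]
    · simp [h]
    · linarith

/-- This is the soundness half, which keeps the returned points inside K≥ even when they are not
extreme. -/
theorem of_mem_algDiag {lo hi d c s t : ℝ} (hd : 0 < d) (hlh : lo ≤ hi)
    (ht : t ∈ algDiag lo hi d c s) : (lo ≤ t ∧ t ≤ hi) ∧ t * d ≤ c ^ 2 + s ^ 2 := by
  rw [← le_div_iff₀ hd]
  simp only [algDiag] at ht
  split_ifs at ht with h1 h2
  · simp at ht
  all_goals
    simp only [Finset.mem_insert, Finset.mem_singleton] at ht
    rcases ht with rfl | rfl <;> refine ⟨⟨?_, ?_⟩, ?_⟩ <;> linarith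

theorem mem_algC_of {lo hi a b s t : ℝ} (h0 : 0 ≤ lo) (hlo : lo ≤ t) (hhi : t ≤ hi)
    (hq : a * b - s ^ 2 ≤ t ^ 2) (ht : AtBound lo hi t ∨ t ^ 2 = a * b - s ^ 2) :
    t ∈ algC lo hi a b s := by
  -- This also covers a negative radicand, whose root is 0 by convention, because `t ≥ 0`.
  have hφ : √(a * b - s ^ 2) ≤ t := Real.sqrt_le_iff.2 ⟨h0.trans hlo, hq⟩
  have ht' : t = lo ∨ t = hi ∨ (0 ≤ a * b - s ^ 2 ∧ t = √(a * b - s ^ 2)) := by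
    rcases ht with (h | h) | h
    · exact Or.inl h
    · exact Or.inr (Or.inl h)
    · exact Or.inr (Or.inr ⟨by rw [← h]; positivity, by rw [← h, Real.sqrt_sq (h0.trans hlo)]⟩)
  simp only [algC]
  split_ifs with h1 h2 h3
  · rcases ht' with h | h | h
    · simp [h]
    · simp [h]
    · linarith [h.1]
  · rcases ht' with h | h | h
    · simp [h]
    · simp [h]
    · linarith [h.2]
  · rcases ht' with h | h | h
    · have : t = √(a * b - s ^ 2) := by linarith
      simp [this]
    · simp [h]
    · simp [← h.2]
  · linarith

theorem of_mem_algC {lo hi a b s t : ℝ} (h0 : 0 ≤ lo) (hlh : lo ≤ hi)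
    (ht : t ∈ algC lo hi a b s) : (lo ≤ t ∧ t ≤ hi) ∧ a * b - s ^ 2 ≤ t ^ 2 := by
  simp only [algC] at ht
  split_ifs at ht with h1 h2 h3
  · simp only [Finset.mem_insert, Finset.mem_singleton] at ht
    rcases ht with rfl | rfl <;> exact ⟨⟨by linarith, by linarith⟩, by nlinarith⟩
  · simp only [Finset.mem_insert, Finset.mem_singleton] at ht
    rw [← Real.sqrt_le_left (by rcases ht with rfl | rfl <;> linarith)]
    rcases ht with rfl | rfl <;> refine ⟨⟨?_, ?_⟩, ?_⟩ <;> linarith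
  · simp only [Finset.mem_insert, Finset.mem_singleton] at ht
    rw [← Real.sqrt_le_left (by rcases ht with rfl | rfl <;> linarith)]
    rcases ht with rfl | rfl <;> refine ⟨⟨?_, ?_⟩, ?_⟩ <;> linarith
  · simp at ht

theorem mem_algS_of {lo hi a b c t : ℝ} (hlo : lo ≤ t) (hhi : t ≤ hi)
    (hq : a * b - c ^ 2 ≤ t ^ 2) (ht : AtBound lo hi t ∨ t ^ 2 = a * b - c ^ 2) :
    t ∈ algS lo hi a b c := by
  simp only [algS]
  by_cases hneg : a * b - c ^ 2 < 0
  · rw [if_pos hneg]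
    rcases ht with (h | h) | h
    · simp [h]
    · simp [h]
    · nlinarith [sq_nonneg t]
  · push Not at hneg
    have hr0 := Real.sqrt_nonneg (a * b - c ^ 2)
    have hr := Real.sq_sqrt hneg
    rw [if_neg hneg.not_gt]
    set r := √(a * b - c ^ 2)
    rw [← hr] at hq ht
    -- The feasible set on an s_ij edge has two branches, since s_ij may have either sign; the
    -- remaining case analysis is linear in `r`.
    have hsplit : t ≤ -r ∨ r ≤ t := by
      rcases le_abs.1 ((abs_of_nonneg hr0).symm.trans_le (sq_le_sq.1 hq)) with h | h
      · exact Or.inr h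
      · exact Or.inl (by linarith)
    have ht' : t = lo ∨ t = hi ∨ t = r ∨ t = -r := by
      rcases ht with (h | h) | h
      · exact Or.inl h
      · exact Or.inr (Or.inl h)
      · exact Or.inr (Or.inr (sq_eq_sq_iff_eq_or_eq_neg.1 h))
    split_ifs <;> simp only [Finset.mem_insert, Finset.mem_singleton, Finset.notMem_empty] <;>
      grind

theorem of_mem_algS {lo hi a b c t : ℝ} (hlh : lo ≤ hi)
    (ht : t ∈ algS lo hi a b c) : (lo ≤ t ∧ t ≤ hi) ∧ a * b - c ^ 2 ≤ t ^ 2 := by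
  simp only [algS] at ht
  by_cases hneg : a * b - c ^ 2 < 0
  · rw [if_pos hneg] at ht
    simp only [Finset.mem_insert, Finset.mem_singleton] at ht
    exact ⟨by rcases ht with rfl | rfl <;> constructor <;> linarith, by nlinarith [sq_nonneg t]⟩
  · rw [if_neg hneg] at ht
    push Not at hneg
    have hr0 := Real.sqrt_nonneg (a * b - c ^ 2)
    have hr := Real.sq_sqrt hneg
    set r := √(a * b - c ^ 2)
    have key : (lo ≤ t ∧ t ≤ hi) ∧ (t ≤ -r ∨ r ≤ t) := by
      split_ifs at ht <;>
        simp only [Finset.mem_insert, Finset.mem_singleton, Finset.notMem_empty] at ht <;> grind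
    refine ⟨key.1, ?_⟩
    rw [← hr]
    rcases key.2 with h | h <;> nlinarith

theorem mem_pointsCii {B : EdgeBox} {z : EdgePoint} :
    z ∈ B.pointsCii ↔ AtBound B.cjjLo B.cjjHi z.2.1 ∧ AtBound B.cijLo B.cijHi z.2.2.1 ∧
      AtBound B.sijLo B.sijHi z.2.2.2 ∧
      z.1 ∈ algDiag B.ciiLo B.ciiHi z.2.1 z.2.2.1 z.2.2.2 := by
  obtain ⟨a, b, c, s⟩ := z
  simp only [pointsCii, AtBound, Finset.mem_biUnion, Finset.mem_product, Finset.mem_image,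
    Finset.mem_insert, Finset.mem_singleton]
  constructor
  · rintro ⟨⟨b', c', s'⟩, ⟨h2, h3, h4⟩, t, ht, heq⟩
    simp only [Prod.mk.injEq] at heq
    obtain ⟨rfl, rfl, rfl, rfl⟩ := heq
    exact ⟨h2, h3, h4, ht⟩
  · rintro ⟨h2, h3, h4, h1⟩
    exact ⟨(b, c, s), ⟨h2, h3, h4⟩, a, h1, rfl⟩

theorem mem_pointsCjj {B : EdgeBox} {z : EdgePoint} :
    z ∈ B.pointsCjj ↔ AtBound B.ciiLo B.ciiHi z.1 ∧ AtBound B.cijLo B.cijHi z.2.2.1 ∧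
      AtBound B.sijLo B.sijHi z.2.2.2 ∧
      z.2.1 ∈ algDiag B.cjjLo B.cjjHi z.1 z.2.2.1 z.2.2.2 := by
  obtain ⟨a, b, c, s⟩ := z
  simp only [pointsCjj, AtBound, Finset.mem_biUnion, Finset.mem_product, Finset.mem_image,
    Finset.mem_insert, Finset.mem_singleton]
  constructor
  · rintro ⟨⟨a', c', s'⟩, ⟨h2, h3, h4⟩, t, ht, heq⟩
    simp only [Prod.mk.injEq] at heq
    obtain ⟨rfl, rfl, rfl, rfl⟩ := heq
    exact ⟨h2, h3, h4, ht⟩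
  · rintro ⟨h2, h3, h4, h1⟩
    exact ⟨(a, c, s), ⟨h2, h3, h4⟩, b, h1, rfl⟩

theorem mem_pointsCij {B : EdgeBox} {z : EdgePoint} :
    z ∈ B.pointsCij ↔ AtBound B.ciiLo B.ciiHi z.1 ∧ AtBound B.cjjLo B.cjjHi z.2.1 ∧
      AtBound B.sijLo B.sijHi z.2.2.2 ∧
      z.2.2.1 ∈ algC B.cijLo B.cijHi z.1 z.2.1 z.2.2.2 := by
  obtain ⟨a, b, c, s⟩ := z
  simp only [pointsCij, AtBound, Finset.mem_biUnion, Finset.mem_product, Finset.mem_image,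
    Finset.mem_insert, Finset.mem_singleton]
  constructor
  · rintro ⟨⟨a', b', s'⟩, ⟨h2, h3, h4⟩, t, ht, heq⟩
    simp only [Prod.mk.injEq] at heq
    obtain ⟨rfl, rfl, rfl, rfl⟩ := heq
    exact ⟨h2, h3, h4, ht⟩
  · rintro ⟨h2, h3, h4, h1⟩
    exact ⟨(a, b, s), ⟨h2, h3, h4⟩, c, h1, rfl⟩

theorem mem_pointsSij {B : EdgeBox} {z : EdgePoint} :
    z ∈ B.pointsSij ↔ AtBound B.ciiLo B.ciiHi z.1 ∧ AtBound B.cjjLo B.cjjHi z.2.1 ∧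
      AtBound B.cijLo B.cijHi z.2.2.1 ∧
      z.2.2.2 ∈ algS B.sijLo B.sijHi z.1 z.2.1 z.2.2.1 := by
  obtain ⟨a, b, c, s⟩ := z
  simp only [pointsSij, AtBound, Finset.mem_biUnion, Finset.mem_product, Finset.mem_image,
    Finset.mem_insert, Finset.mem_singleton]
  constructor
  · rintro ⟨⟨a', b', c'⟩, ⟨h2, h3, h4⟩, t, ht, heq⟩
    simp only [Prod.mk.injEq] at heq
    obtain ⟨rfl, rfl, rfl, rfl⟩ := heq
    exact ⟨h2, h3, h4, ht⟩
  · rintro ⟨h2, h3, h4, h1⟩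
    exact ⟨(a, b, c), ⟨h2, h3, h4⟩, s, h1, rfl⟩

theorem mem_algPoints {B : EdgeBox} {z : EdgePoint} :
    z ∈ B.algPoints ↔ z ∈ B.pointsCii ∨ z ∈ B.pointsCjj ∨ z ∈ B.pointsCij ∨ z ∈ B.pointsSij := by
  simp [algPoints]

theorem AtBound.mem {lo hi x : ℝ} (h : lo ≤ hi) (hx : AtBound lo hi x) : lo ≤ x ∧ x ≤ hi := by
  rcases hx with rfl | rfl <;> constructor <;> linarith

theorem algPoints_subset_KGe {B : EdgeBox} (hcii : 0 < B.ciiLo) (hcjj : 0 < B.cjjLo)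
    (hcij : 0 ≤ B.cijLo) (hii : B.ciiLo ≤ B.ciiHi) (hjj : B.cjjLo ≤ B.cjjHi)
    (hij : B.cijLo ≤ B.cijHi) (hs : B.sijLo ≤ B.sijHi) :
    (B.algPoints : Set EdgePoint) ⊆ B.KGe := by
  intro z hz
  rw [mem_KGe, mem_D, quad]
  rcases mem_algPoints.1 hz with h | h | h | h
  · obtain ⟨h2, h3, h4, h1⟩ := mem_pointsCii.1 h
    obtain ⟨h1, hq⟩ := of_mem_algDiag (hcjj.trans_le (h2.mem hjj).1) hii h1
    exact ⟨⟨h1, h2.mem hjj, h3.mem hij, h4.mem hs⟩, by linarith⟩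
  · obtain ⟨h1, h3, h4, h2⟩ := mem_pointsCjj.1 h
    obtain ⟨h2, hq⟩ := of_mem_algDiag (hcii.trans_le (h1.mem hii).1) hjj h2
    exact ⟨⟨h1.mem hii, h2, h3.mem hij, h4.mem hs⟩, by linarith⟩
  · obtain ⟨h1, h2, h4, h3⟩ := mem_pointsCij.1 h
    obtain ⟨h3, hq⟩ := of_mem_algC hcij hij h3
    exact ⟨⟨h1.mem hii, h2.mem hjj, h3, h4.mem hs⟩, by linarith⟩
  · obtain ⟨h1, h2, h3, h4⟩ := mem_pointsSij.1 h
    obtain ⟨h4, hq⟩ := of_mem_algS hs h4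
    exact ⟨⟨h1.mem hii, h2.mem hjj, h3.mem hij, h4⟩, by linarith⟩

/-- The classification of extreme points leaves only feasible bounds and roots of `quad` on edges,
exactly what the completeness lemmas detect. -/
theorem extremePoints_subset_algPoints {B : EdgeBox} (hcii : 0 < B.ciiLo) (hcjj : 0 < B.cjjLo)
    (hcij : 0 ≤ B.cijLo) :
    (convexHull ℝ B.KGe).extremePoints ℝ ⊆ (B.algPoints : Set EdgePoint) := by
  intro e he
  obtain ⟨heD, hq⟩ := mem_KGe.1 (extremePoints_convexHull_subset he)
  obtain ⟨hD1, hD2, hD3, hD4⟩ := mem_D.1 heD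
  rw [Finset.mem_coe, mem_algPoints]
  have hcases := extremePoints_cases hcii hcjj he
  rw [quad] at hq hcases
  rcases hcases with ⟨h1, h2, h3, h4⟩ | ⟨-, h2, h3, h4, h0⟩ | ⟨-, h1, h3, h4, h0⟩ |
    ⟨-, h1, h2, h4, h0⟩ | ⟨-, h1, h2, h3, h0⟩
  -- A vertex lies on an edge of every type; the c_ii edge through it suffices.
  · exact Or.inl (mem_pointsCii.2 ⟨h2, h3, h4, mem_algDiag_of (hcjj.trans_le hD2.1) hD1.1 hD1.2
      (by linarith) (Or.inl h1)⟩)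
  · exact Or.inl (mem_pointsCii.2 ⟨h2, h3, h4, mem_algDiag_of (hcjj.trans_le hD2.1) hD1.1 hD1.2
      (by linarith) (Or.inr (by linarith))⟩)
  · exact Or.inr (Or.inl (mem_pointsCjj.2 ⟨h1, h3, h4, mem_algDiag_of (hcii.trans_le hD1.1)
      hD2.1 hD2.2 (by linarith) (Or.inr (by linarith))⟩))
  · exact Or.inr (Or.inr (Or.inl (mem_pointsCij.2 ⟨h1, h2, h4, mem_algC_of hcij hD3.1 hD3.2
      (by linarith) (Or.inr (by linarith))⟩)))
  · exact Or.inr (Or.inr (Or.inr (mem_pointsSij.2 ⟨h1, h2, h3, mem_algS_of hD4.1 hD4.2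
      (by linarith) (Or.inr (by linarith))⟩)))

end EdgeBox

/-! ### Counting extreme points -/

namespace EdgeBox

/-- On a segment `p + t • d`, `lo ≤ t ≤ hi`, of the box along which `quad` is convex, at most one
relatively interior point is extreme in the hull of `K≥`; if there is one, then exactly one end
of the segment satisfies the quadratic constraint. -/
theorem card_extremePoints_on_segment {B : EdgeBox} {p d : EdgePoint} {lo hi : ℝ} (hd : d ≠ 0)
    (hqd : 0 ≤ quad d) (hlo : p + lo • d ∈ B.D) (hhi : p + hi • d ∈ B.D) (F : Finset EdgePoint)
    (hF : ∀ e ∈ F, e ∈ (convexHull ℝ B.KGe).extremePoints ℝ ∧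
      ∃ t, (lo < t ∧ t < hi) ∧ e = p + t • d) :
    F.card ≤ 1 ∧ (F.Nonempty → (0 ≤ quad (p + lo • d) ↔ ¬ 0 ≤ quad (p + hi • d))) := by
  have hbetween : ∀ t₁ t t₂ : ℝ, t₁ < t → t < t₂ → p + t₁ • d ∈ convexHull ℝ B.KGe →
      p + t₂ • d ∈ convexHull ℝ B.KGe → p + t • d ∉ (convexHull ℝ B.KGe).extremePoints ℝ := by
    intro t₁ t t₂ h1 h2 hm1 hm2 he
    have hpos : 0 < t₂ - t₁ := by linarith
    have := (mem_extremePoints_iff_left.1 he).2 _ hm1 _ hm2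
      ⟨(t₂ - t) / (t₂ - t₁), (t - t₁) / (t₂ - t₁), div_pos (by linarith) hpos,
        div_pos (by linarith) hpos, by field_simp; ring, by
          have hs : (t₂ - t) / (t₂ - t₁) = 1 - (t - t₁) / (t₂ - t₁) := by field_simp; ring
          have ht : t = t₁ + (t - t₁) / (t₂ - t₁) * (t₂ - t₁) := by field_simp; ring
          have hcomb : (1 - (t - t₁) / (t₂ - t₁)) • (p + t₁ • d) + ((t - t₁) / (t₂ - t₁)) •
              (p + t₂ • d) = p + (t₁ + (t - t₁) / (t₂ - t₁) * (t₂ - t₁)) • d := by module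
          rw [hs, hcomb, ← ht]⟩
    have h0 : (t₁ - t) • d = 0 := by
      rw [sub_smul, add_left_cancel this, sub_self]
    exact hd ((smul_eq_zero.1 h0).resolve_left (by linarith))
  have hmem : ∀ t : ℝ, p + t • d ∈ B.D → 0 ≤ quad (p + t • d) → p + t • d ∈ convexHull ℝ B.KGe :=
    fun t hD hq => subset_convexHull ℝ _ (mem_KGe.2 ⟨hD, hq⟩)
  have hnonneg : ∀ t : ℝ, p + t • d ∈ (convexHull ℝ B.KGe).extremePoints ℝ →
      0 ≤ quad (p + t • d) := fun t he => (mem_KGe.1 (extremePoints_convexHull_subset he)).2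
  have hor : ∀ t : ℝ, lo < t → t < hi → p + t • d ∈ (convexHull ℝ B.KGe).extremePoints ℝ →
      0 ≤ quad (p + lo • d) ∨ 0 ≤ quad (p + hi • d) := by
    intro t h1 h2 he
    by_contra! hneg
    have hq := hnonneg t he
    rw [quad_add_smul] at hneg hq
    rw [quad_add_smul] at hneg
    have hA : 0 < hi - t := by linarith
    have hB : 0 < t - lo := by linarith
    -- Convexity along the segment: (hi − lo) q(t) = (hi − t) q(lo) + (t − lo) q(hi) − quad(d) (hi −
    -- t)(t − lo)(hi − lo), where q(t) is `quad (p + t • d)`. Two negative ends would make the right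
    -- side negative.
    nlinarith [mul_pos hA (neg_pos.2 hneg.1), mul_pos hB (neg_pos.2 hneg.2),
      mul_nonneg hqd (mul_pos (mul_pos hA hB) (add_pos hA hB)).le,
      mul_nonneg hq (add_pos hA hB).le]
  constructor
  · rw [Finset.card_le_one]
    have hlt : ∀ t t' : ℝ, lo < t → t < t' → t' < hi →
        p + t • d ∈ (convexHull ℝ B.KGe).extremePoints ℝ →
        p + t' • d ∈ (convexHull ℝ B.KGe).extremePoints ℝ → False := by
      intro t t' h1 h2 h3 he he'
      rcases hor t h1 (h2.trans h3) he with h | h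
      · exact hbetween lo t t' h1 h2 (hmem _ hlo h) he'.1 he
      · exact hbetween t t' hi h2 h3 he.1 (hmem _ hhi h) he'
    intro e he e' he'
    obtain ⟨hex, t, ht, rfl⟩ := hF e he
    obtain ⟨hex', t', ht', rfl⟩ := hF e' he'
    rcases lt_trichotomy t t' with h | rfl | h
    · exact (hlt t t' ht.1 h ht'.2 hex hex').elim
    · rfl
    · exact (hlt t' t ht'.1 h ht.2 hex' hex).elim
  · rintro ⟨e, he⟩
    obtain ⟨hex, t, ht, rfl⟩ := hF e he
    refine ⟨fun h1 h2 => hbetween lo t hi ht.1 ht.2 (hmem _ hlo h1) (hmem _ hhi h2) hex,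
      fun h => (hor t ht.1 ht.2 hex).resolve_right h⟩

/-- The lower or the upper bound, as a Boolean selects. -/
def bound (lo hi : ℝ) (i : Bool) : ℝ := if i then hi else lo

theorem exists_bound_eq {lo hi x : ℝ} (h : AtBound lo hi x) : ∃ i, bound lo hi i = x := by
  rcases h with rfl | rfl
  · exact ⟨false, rfl⟩
  · exact ⟨true, rfl⟩

theorem bound_mem {lo hi : ℝ} (h : lo ≤ hi) (i : Bool) :
    lo ≤ bound lo hi i ∧ bound lo hi i ≤ hi := by
  cases i <;> simp [bound, h]

/-- The vertex of the box selected by four Booleans. -/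
def vertex (B : EdgeBox) (i j k l : Bool) : EdgePoint :=
  (bound B.ciiLo B.ciiHi i, bound B.cjjLo B.cjjHi j, bound B.cijLo B.cijHi k,
    bound B.sijLo B.sijHi l)

/-- `1` if the point satisfies `c_ij² + s_ij² ≥ c_ii c_jj`, `0` otherwise. -/
noncomputable def geInd (z : EdgePoint) : ℤ :=
  open Classical in if 0 ≤ quad z then 1 else 0

theorem geInd_le_one (z : EdgePoint) : geInd z ≤ 1 := by
  unfold geInd; split_ifs <;> simp

theorem card_le_sum_of_forall_exists {ι α : Type*} [Fintype ι] [DecidableEq α] {F : Finset α}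
    {P : ι → α → Prop} [∀ i, DecidablePred (P i)] (h : ∀ e ∈ F, ∃ i, P i e) {n : ι → ℤ}
    (hn : ∀ i, ((F.filter (P i)).card : ℤ) ≤ n i) : (F.card : ℤ) ≤ ∑ i, n i := by
  have hsub : F ⊆ Finset.univ.biUnion fun i => F.filter (P i) := fun e he => by
    obtain ⟨i, hi⟩ := h e he
    simpa using ⟨he, i, hi⟩
  have hcard := (Finset.card_le_card hsub).trans Finset.card_biUnion_le
  calc (F.card : ℤ) ≤ ∑ i, ((F.filter (P i)).card : ℤ) := by exact_mod_cast hcard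
    _ ≤ ∑ i, n i := Finset.sum_le_sum fun i _ => hn i

/-- Counting the extreme points in the relative interiors of finitely many parallel segments. -/
theorem card_extremePoints_on_segments_le {B : EdgeBox} {ι : Type*} [Fintype ι]
    {F : Finset EdgePoint} (hF : ∀ e ∈ F, e ∈ (convexHull ℝ B.KGe).extremePoints ℝ)
    {p : ι → EdgePoint} {d : EdgePoint} {lo hi : ℝ} (hd : d ≠ 0) (hqd : 0 ≤ quad d)
    (hlo : ∀ v, p v + lo • d ∈ B.D) (hhi : ∀ v, p v + hi • d ∈ B.D)
    (hcov : ∀ e ∈ F, ∃ v t, (lo < t ∧ t < hi) ∧ e = p v + t • d) :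
    (F.card : ℤ) ≤ Fintype.card ι ∧
    ((∀ v, 0 ≤ quad (p v + lo • d) → 0 ≤ quad (p v + hi • d)) →
      (F.card : ℤ) ≤ ∑ v, (geInd (p v + hi • d) - geInd (p v + lo • d))) ∧
    ((∀ v, 0 ≤ quad (p v + hi • d) → 0 ≤ quad (p v + lo • d)) →
      (F.card : ℤ) ≤ ∑ v, (geInd (p v + lo • d) - geInd (p v + hi • d))) := by
  classical
  have hseg := fun v => card_extremePoints_on_segment hd hqd (hlo v) (hhi v)
    (F.filter fun e => ∃ t, (lo < t ∧ t < hi) ∧ e = p v + t • d)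
    fun e he => ⟨hF e (Finset.mem_filter.1 he).1, (Finset.mem_filter.1 he).2⟩
  refine ⟨?_, fun hmono => ?_, fun hmono => ?_⟩
  · simpa using card_le_sum_of_forall_exists hcov (n := fun _ => 1)
      fun v => by exact_mod_cast (hseg v).1
  all_goals
    refine card_le_sum_of_forall_exists hcov fun v => ?_
    obtain ⟨h1, h2⟩ := hseg v
    have hm := hmono v
    unfold geInd
    -- Monotonicity makes the indicator difference nonnegative; if the segment contributes a point,
    -- exactly one end is feasible and the difference is 1.
    rcases Finset.eq_empty_or_nonempty
      (F.filter fun e => ∃ t, (lo < t ∧ t < hi) ∧ e = p v + t • d) with h | h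
    · rw [h, Finset.card_empty]
      split_ifs <;> simp_all
    · have h1' : ((F.filter fun e => ∃ t, (lo < t ∧ t < hi) ∧ e = p v + t • d).card : ℤ) ≤ 1 := by
        exact_mod_cast h1
      have h2' := h2 h
      split_ifs <;> tauto

theorem vertex_mem_D {B : EdgeBox} (hii : B.ciiLo ≤ B.ciiHi) (hjj : B.cjjLo ≤ B.cjjHi)
    (hij : B.cijLo ≤ B.cijHi) (hs : B.sijLo ≤ B.sijHi) (i j k l : Bool) :
    B.vertex i j k l ∈ B.D :=
  mem_D.2 ⟨bound_mem hii i, bound_mem hjj j, bound_mem hij k, bound_mem hs l⟩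

section Count

variable {B : EdgeBox} {F : Finset EdgePoint}

theorem card_vertices_le (hF : ∀ e ∈ F, e ∈ (convexHull ℝ B.KGe).extremePoints ℝ)
    (hb : ∀ e ∈ F, AtBound B.ciiLo B.ciiHi e.1 ∧ AtBound B.cjjLo B.cjjHi e.2.1 ∧
      AtBound B.cijLo B.cijHi e.2.2.1 ∧ AtBound B.sijLo B.sijHi e.2.2.2) :
    (F.card : ℤ) ≤ ∑ v : Bool × Bool × Bool × Bool, geInd (B.vertex v.1 v.2.1 v.2.2.1 v.2.2.2) := by
  classical
  refine card_le_sum_of_forall_exists (P := fun v e => e = B.vertex v.1 v.2.1 v.2.2.1 v.2.2.2)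
    (fun e he => ?_) fun v => ?_
  · obtain ⟨h1, h2, h3, h4⟩ := hb e he
    obtain ⟨i, hi⟩ := exists_bound_eq h1
    obtain ⟨j, hj⟩ := exists_bound_eq h2
    obtain ⟨k, hk⟩ := exists_bound_eq h3
    obtain ⟨l, hl⟩ := exists_bound_eq h4
    exact ⟨(i, j, k, l), by simp [vertex, hi, hj, hk, hl]⟩
  · unfold geInd
    split_ifs with h
    · rw [Nat.cast_le_one, Finset.card_le_one]
      exact fun a ha b hb => (Finset.mem_filter.1 ha).2.trans (Finset.mem_filter.1 hb).2.symm
    · rw [Nat.cast_nonpos, Finset.card_eq_zero, Finset.filter_eq_empty_iff]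
      rintro e he rfl
      exact h (mem_KGe.1 (extremePoints_convexHull_subset (hF _ he))).2

/-- As c_jj > 0, `quad` decreases in c_ii, so feasibility at the upper end forces it at the lower
end. -/
theorem card_interior_cii_le
    (hcjj : 0 < B.cjjLo) (hii : B.ciiLo ≤ B.ciiHi) (hjj : B.cjjLo ≤ B.cjjHi)
    (hij : B.cijLo ≤ B.cijHi) (hs : B.sijLo ≤ B.sijHi)
    (hF : ∀ e ∈ F, e ∈ (convexHull ℝ B.KGe).extremePoints ℝ)
    (hb : ∀ e ∈ F, (B.ciiLo < e.1 ∧ e.1 < B.ciiHi) ∧ AtBound B.cjjLo B.cjjHi e.2.1 ∧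
      AtBound B.cijLo B.cijHi e.2.2.1 ∧ AtBound B.sijLo B.sijHi e.2.2.2) :
    (F.card : ℤ) ≤ ∑ v : Bool × Bool × Bool,
      (geInd (B.vertex false v.1 v.2.1 v.2.2) - geInd (B.vertex true v.1 v.2.1 v.2.2)) := by
  -- The zero in the varying slot makes the segment parameter equal to that coordinate.
  let p : Bool × Bool × Bool → EdgePoint := fun v =>
    (0, bound B.cjjLo B.cjjHi v.1,
      bound B.cijLo B.cijHi v.2.1, bound B.sijLo B.sijHi v.2.2)
  have hp : ∀ v i, p v + bound B.ciiLo B.ciiHi i • ((1, 0, 0, 0) : EdgePoint) =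
      B.vertex i v.1 v.2.1 v.2.2 := fun v i => by
    simp [p, vertex]
  have hvD := vertex_mem_D hii hjj hij hs
  have hcount := card_extremePoints_on_segments_le hF (p := p) (d := (1, 0, 0, 0))
    (lo := bound B.ciiLo B.ciiHi false) (hi := bound B.ciiLo B.ciiHi true)
    (by simp) (by simp [quad]) (fun v => by rw [hp]; exact hvD _ _ _ _)
    (fun v => by rw [hp]; exact hvD _ _ _ _) fun e he => by
      obtain ⟨h0, h1, h2, h3⟩ := hb e he
      obtain ⟨i, hi⟩ := exists_bound_eq h1
      obtain ⟨j, hj⟩ := exists_bound_eq h2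
      obtain ⟨k, hk⟩ := exists_bound_eq h3
      exact ⟨(i, j, k), e.1, h0, by simp [p, hi, hj, hk, Prod.ext_iff]⟩
  simp only [hp] at hcount
  refine hcount.2.2 fun v h => ?_
  have h1 := (bound_mem hjj v.1).1
  simp only [quad, vertex, bound] at h1 h ⊢
  simp only [if_true, Bool.false_eq_true, if_false] at h ⊢
  nlinarith [mul_nonneg (sub_nonneg.2 hii) (hcjj.le.trans h1)]

theorem card_interior_cjj_le
    (hcii : 0 < B.ciiLo) (hii : B.ciiLo ≤ B.ciiHi) (hjj : B.cjjLo ≤ B.cjjHi)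
    (hij : B.cijLo ≤ B.cijHi) (hs : B.sijLo ≤ B.sijHi)
    (hF : ∀ e ∈ F, e ∈ (convexHull ℝ B.KGe).extremePoints ℝ)
    (hb : ∀ e ∈ F, (B.cjjLo < e.2.1 ∧ e.2.1 < B.cjjHi) ∧ AtBound B.ciiLo B.ciiHi e.1 ∧
      AtBound B.cijLo B.cijHi e.2.2.1 ∧ AtBound B.sijLo B.sijHi e.2.2.2) :
    (F.card : ℤ) ≤ ∑ v : Bool × Bool × Bool,
      (geInd (B.vertex v.1 false v.2.1 v.2.2) - geInd (B.vertex v.1 true v.2.1 v.2.2)) := by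
  let p : Bool × Bool × Bool → EdgePoint := fun v =>
    (bound B.ciiLo B.ciiHi v.1, 0,
      bound B.cijLo B.cijHi v.2.1, bound B.sijLo B.sijHi v.2.2)
  have hp : ∀ v i, p v + bound B.cjjLo B.cjjHi i • ((0, 1, 0, 0) : EdgePoint) =
      B.vertex v.1 i v.2.1 v.2.2 := fun v i => by
    simp [p, vertex]
  have hvD := vertex_mem_D hii hjj hij hs
  have hcount := card_extremePoints_on_segments_le hF (p := p) (d := (0, 1, 0, 0))
    (lo := bound B.cjjLo B.cjjHi false) (hi := bound B.cjjLo B.cjjHi true)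
    (by simp) (by simp [quad]) (fun v => by rw [hp]; exact hvD _ _ _ _)
    (fun v => by rw [hp]; exact hvD _ _ _ _) fun e he => by
      obtain ⟨h0, h1, h2, h3⟩ := hb e he
      obtain ⟨i, hi⟩ := exists_bound_eq h1
      obtain ⟨j, hj⟩ := exists_bound_eq h2
      obtain ⟨k, hk⟩ := exists_bound_eq h3
      exact ⟨(i, j, k), e.2.1, h0, by simp [p, hi, hj, hk, Prod.ext_iff]⟩
  simp only [hp] at hcount
  refine hcount.2.2 fun v h => ?_
  have h1 := (bound_mem hii v.1).1
  simp only [quad, vertex, bound] at h1 h ⊢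
  simp only [if_true, Bool.false_eq_true, if_false] at h ⊢
  nlinarith [mul_nonneg (sub_nonneg.2 hjj) (hcii.le.trans h1)]

/-- Here `quad` increases on the edge because c_ij ≥ 0, so the difference has the opposite sign from
the diagonal cases. -/
theorem card_interior_cij_le
    (hcij : 0 ≤ B.cijLo) (hii : B.ciiLo ≤ B.ciiHi) (hjj : B.cjjLo ≤ B.cjjHi)
    (hij : B.cijLo ≤ B.cijHi) (hs : B.sijLo ≤ B.sijHi)
    (hF : ∀ e ∈ F, e ∈ (convexHull ℝ B.KGe).extremePoints ℝ)
    (hb : ∀ e ∈ F, (B.cijLo < e.2.2.1 ∧ e.2.2.1 < B.cijHi) ∧ AtBound B.ciiLo B.ciiHi e.1 ∧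
      AtBound B.cjjLo B.cjjHi e.2.1 ∧ AtBound B.sijLo B.sijHi e.2.2.2) :
    (F.card : ℤ) ≤ ∑ v : Bool × Bool × Bool,
      (geInd (B.vertex v.1 v.2.1 true v.2.2) - geInd (B.vertex v.1 v.2.1 false v.2.2)) := by
  let p : Bool × Bool × Bool → EdgePoint := fun v =>
    (bound B.ciiLo B.ciiHi v.1, bound B.cjjLo B.cjjHi v.2.1,
      0, bound B.sijLo B.sijHi v.2.2)
  have hp : ∀ v i, p v + bound B.cijLo B.cijHi i • ((0, 0, 1, 0) : EdgePoint) =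
      B.vertex v.1 v.2.1 i v.2.2 := fun v i => by
    simp [p, vertex]
  have hvD := vertex_mem_D hii hjj hij hs
  have hcount := card_extremePoints_on_segments_le hF (p := p) (d := (0, 0, 1, 0))
    (lo := bound B.cijLo B.cijHi false) (hi := bound B.cijLo B.cijHi true)
    (by simp) (by simp [quad]) (fun v => by rw [hp]; exact hvD _ _ _ _)
    (fun v => by rw [hp]; exact hvD _ _ _ _) fun e he => by
      obtain ⟨h0, h1, h2, h3⟩ := hb e he
      obtain ⟨i, hi⟩ := exists_bound_eq h1
      obtain ⟨j, hj⟩ := exists_bound_eq h2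
      obtain ⟨k, hk⟩ := exists_bound_eq h3
      exact ⟨(i, j, k), e.2.2.1, h0, by simp [p, hi, hj, hk]⟩
  simp only [hp] at hcount
  refine hcount.2.1 fun v h => ?_
  simp only [quad, vertex, bound] at h ⊢
  simp only [if_true, Bool.false_eq_true, if_false] at h ⊢
  nlinarith [mul_nonneg (sub_nonneg.2 hij) (add_nonneg hcij (hcij.trans hij))]

/-- The sign of s_ij is unrestricted, so monotonicity may fail; only the bound of one point per edge
is available. -/
theorem card_interior_sij_le
    (hii : B.ciiLo ≤ B.ciiHi) (hjj : B.cjjLo ≤ B.cjjHi)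
    (hij : B.cijLo ≤ B.cijHi) (hs : B.sijLo ≤ B.sijHi)
    (hF : ∀ e ∈ F, e ∈ (convexHull ℝ B.KGe).extremePoints ℝ)
    (hb : ∀ e ∈ F, (B.sijLo < e.2.2.2 ∧ e.2.2.2 < B.sijHi) ∧ AtBound B.ciiLo B.ciiHi e.1 ∧
      AtBound B.cjjLo B.cjjHi e.2.1 ∧ AtBound B.cijLo B.cijHi e.2.2.1) :
    (F.card : ℤ) ≤ 8 := by
  let p : Bool × Bool × Bool → EdgePoint := fun v =>
    (bound B.ciiLo B.ciiHi v.1, bound B.cjjLo B.cjjHi v.2.1,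
      bound B.cijLo B.cijHi v.2.2, 0)
  have hp : ∀ v i, p v + bound B.sijLo B.sijHi i • ((0, 0, 0, 1) : EdgePoint) =
      B.vertex v.1 v.2.1 v.2.2 i := fun v i => by
    simp [p, vertex]
  have hvD := vertex_mem_D hii hjj hij hs
  have hcount := card_extremePoints_on_segments_le hF (p := p) (d := (0, 0, 0, 1))
    (lo := bound B.sijLo B.sijHi false) (hi := bound B.sijLo B.sijHi true)
    (by simp) (by simp [quad]) (fun v => by rw [hp]; exact hvD _ _ _ _)
    (fun v => by rw [hp]; exact hvD _ _ _ _) fun e he => by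
      obtain ⟨h0, h1, h2, h3⟩ := hb e he
      obtain ⟨i, hi⟩ := exists_bound_eq h1
      obtain ⟨j, hj⟩ := exists_bound_eq h2
      obtain ⟨k, hk⟩ := exists_bound_eq h3
      exact ⟨(i, j, k), e.2.2.2, h0, by simp [p, hi, hj, hk]⟩
  simpa using hcount.1

end Count

/-- The hull of `K≥` has at most 32 extreme points. -/
theorem card_extremePoints_le {B : EdgeBox} (hcii : 0 < B.ciiLo) (hcjj : 0 < B.cjjLo)
    (hcij : 0 ≤ B.cijLo) (hii : B.ciiLo ≤ B.ciiHi) (hjj : B.cjjLo ≤ B.cjjHi)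
    (hij : B.cijLo ≤ B.cijHi) (hs : B.sijLo ≤ B.sijHi) {Z : Finset EdgePoint}
    (hZ : ∀ e ∈ Z, e ∈ (convexHull ℝ B.KGe).extremePoints ℝ) : Z.card ≤ 32 := by
  classical
  have hunion : ∀ V F₁ F₂ F₃ F₄ : Finset EdgePoint, Z ⊆ V ∪ (F₁ ∪ (F₂ ∪ (F₃ ∪ F₄))) →
      (Z.card : ℤ) ≤ V.card + (F₁.card + (F₂.card + (F₃.card + F₄.card))) := by
    intro V F₁ F₂ F₃ F₄ h
    have h0 := Finset.card_le_card h
    have h1 := Finset.card_union_le V (F₁ ∪ (F₂ ∪ (F₃ ∪ F₄)))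
    have h2 := Finset.card_union_le F₁ (F₂ ∪ (F₃ ∪ F₄))
    have h3 := Finset.card_union_le F₂ (F₃ ∪ F₄)
    have h4 := Finset.card_union_le F₃ F₄
    exact_mod_cast (by omega : Z.card ≤ _)
  have hfilter : ∀ (P : EdgePoint → Prop) [DecidablePred P], ∀ e ∈ Z.filter P,
      e ∈ (convexHull ℝ B.KGe).extremePoints ℝ := fun P _ e he => hZ e (Finset.mem_filter.1 he).1
  have hcard := hunion
    (Z.filter fun e => AtBound B.ciiLo B.ciiHi e.1 ∧ AtBound B.cjjLo B.cjjHi e.2.1 ∧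
      AtBound B.cijLo B.cijHi e.2.2.1 ∧ AtBound B.sijLo B.sijHi e.2.2.2)
    (Z.filter fun e => (B.ciiLo < e.1 ∧ e.1 < B.ciiHi) ∧ AtBound B.cjjLo B.cjjHi e.2.1 ∧
      AtBound B.cijLo B.cijHi e.2.2.1 ∧ AtBound B.sijLo B.sijHi e.2.2.2)
    (Z.filter fun e => (B.cjjLo < e.2.1 ∧ e.2.1 < B.cjjHi) ∧ AtBound B.ciiLo B.ciiHi e.1 ∧
      AtBound B.cijLo B.cijHi e.2.2.1 ∧ AtBound B.sijLo B.sijHi e.2.2.2)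
    (Z.filter fun e => (B.cijLo < e.2.2.1 ∧ e.2.2.1 < B.cijHi) ∧ AtBound B.ciiLo B.ciiHi e.1 ∧
      AtBound B.cjjLo B.cjjHi e.2.1 ∧ AtBound B.sijLo B.sijHi e.2.2.2)
    (Z.filter fun e => (B.sijLo < e.2.2.2 ∧ e.2.2.2 < B.sijHi) ∧ AtBound B.ciiLo B.ciiHi e.1 ∧
      AtBound B.cjjLo B.cjjHi e.2.1 ∧ AtBound B.cijLo B.cijHi e.2.2.1) (by
    intro e he
    simp only [Finset.mem_union, Finset.mem_filter, he, true_and]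
    rcases extremePoints_cases hcii hcjj (hZ e he) with h | ⟨h0, h1, h2, h3, -⟩ |
      ⟨h0, h1, h2, h3, -⟩ | ⟨h0, h1, h2, h3, -⟩ | ⟨h0, h1, h2, h3, -⟩
    · exact Or.inl h
    · exact Or.inr (Or.inl ⟨h0, h1, h2, h3⟩)
    · exact Or.inr (Or.inr (Or.inl ⟨h0, h1, h2, h3⟩))
    · exact Or.inr (Or.inr (Or.inr (Or.inl ⟨h0, h1, h2, h3⟩)))
    · exact Or.inr (Or.inr (Or.inr (Or.inr ⟨h0, h1, h2, h3⟩))))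
  have hV := card_vertices_le (hfilter _) fun e he => (Finset.mem_filter.1 he).2
  have h1 := card_interior_cii_le hcjj hii hjj hij hs (hfilter _)
    fun e he => (Finset.mem_filter.1 he).2
  have h2 := card_interior_cjj_le hcii hii hjj hij hs (hfilter _)
    fun e he => (Finset.mem_filter.1 he).2
  have h3 := card_interior_cij_le hcij hii hjj hij hs (hfilter _)
    fun e he => (Finset.mem_filter.1 he).2
  have h4 := card_interior_sij_le hii hjj hij hs (hfilter _)
    fun e he => (Finset.mem_filter.1 he).2
  have hle := fun i j k l => geInd_le_one (B.vertex i j k l)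
  simp only [Fintype.sum_prod_type, Fintype.sum_bool] at hV h1 h2 h3
  -- In the total, a vertex has weight 1 ± 1 ± 1 ± 1, with plus signs for lower c_ii, lower c_jj and
  -- upper c_ij. The weights are 4 once, 2 three times, 0 three times and −2 once for each `l`, so
  -- the total is at most 2 · 10 + 8 = 28.
  have hl : ∀ l, 4 * geInd (B.vertex false false true l) + 2 * geInd (B.vertex true false true l) +
      2 * geInd (B.vertex false true true l) + 2 * geInd (B.vertex false false false l) ≤ 10 :=
    fun l => by
      linarith [hle false false true l, hle true false true l, hle false true true l,
        hle false false false l]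
  have hpos : ∀ i j k l, 0 ≤ geInd (B.vertex i j k l) := fun i j k l => by
    unfold geInd; split_ifs <;> simp
  have := hl true
  have := hl false
  have := hpos true true false true
  have := hpos true true false false
  have : (Z.card : ℤ) ≤ 32 := by linarith
  exact_mod_cast this

end EdgeBox

/-! ### Assembly -/

open EdgeBox in
theorem mainTheorem3 (B : EdgeBox)
    (hcii : 0 < B.ciiLo) (hcjj : 0 < B.cjjLo) (hcij : 0 ≤ B.cijLo)
    (hii : B.ciiLo ≤ B.ciiHi) (hjj : B.cjjLo ≤ B.cjjHi)
    (hij : B.cijLo ≤ B.cijHi) (hs : B.sijLo ≤ B.sijHi) :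
    convexHull ℝ B.KEq = B.hullDescription B.algPoints ∧
    ∃ Z : Finset EdgePoint,
      (Z : Set EdgePoint) = (convexHull ℝ B.KGe).extremePoints ℝ ∧
      Z ⊆ B.algPoints ∧
      Z.card ≤ 32 ∧
      convexHull ℝ B.KEq = B.hullDescription Z := by
  have hsub := extremePoints_subset_algPoints hcii hcjj hcij
  obtain ⟨Z, hZ⟩ := (B.algPoints.finite_toSet.subset hsub).exists_finset_coe
  have hZsub : Z ⊆ B.algPoints := by rw [← Finset.coe_subset, hZ]; exact hsub
  -- Krein–Milman; the closure is superfluous because there are finitely many extreme points.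
  have hhull : convexHull ℝ (Z : Set EdgePoint) = convexHull ℝ B.KGe := by
    rw [← closure_convexHull_extremePoints
      B.isCompact_KGe.isCompact_convexHull_of_finiteDimensional (convex_convexHull ℝ _), hZ,
      ((B.algPoints.finite_toSet.subset hsub).isCompact_convexHull ℝ).isClosed.closure_eq]
  have hdesc : ∀ W : Finset EdgePoint, convexHull ℝ (W : Set EdgePoint) = convexHull ℝ B.KGe →
      convexHull ℝ B.KEq = B.hullDescription W := fun W hW => by
    ext z
    rw [mem_hullDescription, hW, convexHull_KEq_eq hcii hcjj]
    exact ⟨fun h => ⟨B.convexHull_KGe_subset_D h.1, h.2, h.1⟩, fun h => ⟨h.2.2, h.2.1⟩⟩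
  -- The hull of the returned points is squeezed between the hull of `Z` and that of K≥, which
  -- coincide.
  refine ⟨hdesc _ (Set.Subset.antisymm (convexHull_mono
      (algPoints_subset_KGe hcii hcjj hcij hii hjj hij hs)) ?_), Z, hZ, hZsub,
    card_extremePoints_le hcii hcjj hcij hii hjj hij hs (fun e he => hZ ▸ he), hdesc Z hhull⟩
  rw [← hhull]
  exact convexHull_mono (Finset.coe_subset.2 hZsub)
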